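/- Let $I\subseteq\mathbb{R}$ be an interval containing more than one point (open, closed or half-open, bounded or not). Let $k:I\times I\to\mathbb{R}$ be twice continuously differentiable, symmetric ($k(s,t)=k(t,s)$) and positive (semi-)definite, i.e. $\sum_{i,j=1}^n c_ic_j\,k(t_i,t_j)\ge 0$ for all $n$, all $t_1,\dots,t_n\in I$ and all $c_1,\dots,c_n\in\mathbb{R}$, and let $m:I\to\mathbb{R}$ be continuously differentiable. Derivatives at an endpoint belonging to $I$ are one-sided. Call an $\mathbb{R}^2$-valued stochastic process $(D_t)_{t\in I}$, $D_t=(z_t,z'_t)$, on a probability space a derivative Gaussian process (DGP) with mean function $m$ and kernel $k$ if for all $t_1,\dots,t_n\in I$ the vector $(z_{t_1},\dots,z_{t_n},z'_{t_1},\dots,z'_{t_n})$ is Gaussian (possibly degenerate) with mean $\big(m(t_1),\dots,m(t_n),\tfrac{dm}{dt}(t_1),\dots,\tfrac{dm}{dt}(t_n)\big)$ and covariances $$\operatorname{cov}(z_{t_i},z_{t_j})=k(t_i,t_j),\qquad \operatorname{cov}(z_{t_i},z'_{t_j})=\frac{\partial k}{\partial y}(t_i,t_j),\qquad \operatorname{cov}(z'_{t_i},z'_{t_j})=\frac{\partial^2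 k}{\partial x\,\partial y}(t_i,t_j),$$ where $x$ and $y$ denote the first and the second argument of $k$. Then: (1) There exist a probability space and a DGP $(z_t,z'_t)_{t\in I}$ on it with mean function $m$ and kernel $k$. (2) For every such DGP, on any probability space: $(z_t)_{t\in I}$ is a Gaussian process with mean function $m$ and covariance function $k$; it is $\mathcal{C}^1$ in mean square, i.e. it has an $L^2$ derivative on $I$ that is continuous from $I$ to $L^2$; $(z'_t)_{t\in I}$ is a Gaussian process with mean function $\frac{dm}{dt}$ and covariance function $\frac{\partial^2 k}{\partial x\,\partial y}$; and $(z'_t)_{t\in I}$ is the $L^2$ derivative of $(z_t)_{t\in I}$, i.e. $z_t,z'_t\in L^2$ and $$\lim_{s\to t,\ s\in I\setminus\{t\}}\ \mathbb{E}\Big[\Big(\frac{z_s-z_t}{s-t}-z'_t\Big)^2\Big]=0\qquad\text{for every }t\in I.$$ -/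

import Mathlib

open MeasureTheory ProbabilityTheory Filter Topology

namespace DerivativeGP

/-- `k` is a symmetric positive (semi-)definite function on `I × I`:
`k(s,t) = k(t,s)`, and `∑ᵢⱼ cᵢ cⱼ k(tᵢ,tⱼ) ≥ 0` for all points `tᵢ ∈ I` and real weights `cᵢ`. -/
structure IsKernelOn (I : Set ℝ) (k : ℝ → ℝ → ℝ) : Prop where
  symm : ∀ s ∈ I, ∀ t ∈ I, k s t = k t s
  nonneg : ∀ (n : ℕ) (t : Fin n → I) (c : Fin n → ℝ),
    0 ≤ ∑ i, ∑ j, c i * c j * k (t i) (t j)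

/-- The derivative `dm/dt` of `m` on `I` (one-sided at an endpoint that belongs to `I`). -/
noncomputable def deriv1 (I : Set ℝ) (m : ℝ → ℝ) (t : ℝ) : ℝ :=
  derivWithin m I t

/-- The partial derivative `∂k/∂y (x,y)` on `I × I`, in the second variable. -/
noncomputable def partialY (I : Set ℝ) (k : ℝ → ℝ → ℝ) (x y : ℝ) : ℝ :=
  derivWithin (fun v => k x v) I y

/-- The mixed partial derivative `∂²k/∂x∂y (x,y)` on `I × I`. -/
noncomputable def partialXY (I : Set ℝ) (k : ℝ → ℝ → ℝ) (x y : ℝ) : ℝ :=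
  derivWithin (fun u => partialY I k u y) I x

variable {Ω : Type*} [MeasurableSpace Ω]

/-- `(z_t)_{t ∈ I}` is a Gaussian process with mean function `m` and covariance function `k`. -/
structure IsGP (I : Set ℝ) (m : ℝ → ℝ) (k : ℝ → ℝ → ℝ) (z : I → Ω → ℝ) (P : Measure Ω) :
    Prop where
  measurable : ∀ t, Measurable (z t)
  gaussian : IsGaussianProcess z P
  mean : ∀ t, ∫ ω, z t ω ∂P = m t
  cov : ∀ s t, cov[z s, z t; P] = k s t

/-- `D_t = (z_t, z'_t)`, `t ∈ I`, is a derivative Gaussian process for the mean function `m` and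
the kernel `k`: for all `t₁, …, tₙ ∈ I`, the vector `(z_{t₁}, …, z_{tₙ}, z'_{t₁}, …, z'_{tₙ})` is
Gaussian, with means given by `m` and `dm/dt` and covariances given by `k`, `∂k/∂y` and
`∂²k/∂x∂y`. -/
structure IsDGP (I : Set ℝ) (m : ℝ → ℝ) (k : ℝ → ℝ → ℝ) (D : I → Ω → ℝ × ℝ) (P : Measure Ω) :
    Prop where
  measurable : ∀ t, Measurable (D t)
  gaussian : ∀ (n : ℕ) (t : Fin n → I),
    HasGaussianLaw
      (fun ω => (Sum.elim (fun i => (D (t i) ω).1) (fun i => (D (t i) ω).2) :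
        Fin n ⊕ Fin n → ℝ)) P
  mean_fst : ∀ t, ∫ ω, (D t ω).1 ∂P = m t
  mean_snd : ∀ t, ∫ ω, (D t ω).2 ∂P = deriv1 I m t
  cov_fst_fst : ∀ s t, cov[fun ω => (D s ω).1, fun ω => (D t ω).1; P] = k s t
  cov_fst_snd : ∀ s t, cov[fun ω => (D s ω).1, fun ω => (D t ω).2; P] = partialY I k s t
  cov_snd_snd : ∀ s t, cov[fun ω => (D s ω).2, fun ω => (D t ω).2; P] = partialXY I k s t

/-- `z'` is the `L²` (mean square) derivative of the process `z` on `I`: both are square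
integrable, and `(z_s - z_t)/(s - t) → z'_t` in `L²` as `s → t`, `s ∈ I`, `s ≠ t`, for every
`t ∈ I`. -/
structure IsMSDeriv (I : Set ℝ) (z z' : I → Ω → ℝ) (P : Measure Ω) : Prop where
  memLp : ∀ t, MemLp (z t) 2 P
  memLp_deriv : ∀ t, MemLp (z' t) 2 P
  tendsto : ∀ t : I, Tendsto
    (fun s : I => eLpNorm (fun ω => (z s ω - z t ω) / ((s : ℝ) - t) - z' t ω) 2 P)
    (𝓝[≠] t) (𝓝 0)

/-- The process `z` is continuous in the `L²` (mean square) sense on `I`. -/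
structure IsMSContinuous (I : Set ℝ) (z : I → Ω → ℝ) (P : Measure Ω) : Prop where
  memLp : ∀ t, MemLp (z t) 2 P
  tendsto : ∀ t : I, Tendsto (fun s : I => eLpNorm (fun ω => z s ω - z t ω) 2 P) (𝓝 t) (𝓝 0)

/-- The process `z` is continuously differentiable in the `L²` (mean square) sense on `I`. -/
def IsMSC1 (I : Set ℝ) (z : I → Ω → ℝ) (P : Measure Ω) : Prop :=
  ∃ z' : I → Ω → ℝ, IsMSDeriv I z z' P ∧ IsMSContinuous I z' P

end DerivativeGP

/-! After centring, a process with covariance `k` is a curve `φ` in the Hilbert space `L²` with `⟪φ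
s, φ t⟫ = k s t`, so the analytic claims concern such curves in any Hilbert space. The inner product
of two slopes of `φ` at `t` is a second difference quotient of `k`. By the mean value theorem it is
a value of `∂²k/∂x∂y` near `(t, t)`, so it converges as both increments tend to zero independently.
Hence the slopes are Cauchy and `φ` has a derivative (`exists_hasDerivWithinAt_of_inner_eq`), whose
inner products are the prescribed partials of `k`.

Existence: take a feature map of `k`, differentiate it, and send both curves through an isometry
onto centred Gaussian variables (`exists_isonormal`); then add `m` and its derivative.

Properties: the Gaussian claims are marginals of the joint law. The centred `z'` has the same inner
products with the centred `z`, and with itself, as the derivative would have, so it is at distance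
zero from it (`hasDerivWithinAt_of_inner_eq`). Continuity of `z'` follows from continuity of its
covariance. -/

namespace DerivativeGP

/-! ### Mixed partials and second differences of the kernel. -/

section Calculus

variable {I : Set ℝ} {k : ℝ → ℝ → ℝ}

lemma uniqueDiffOn_of_ordConnected (hI : I.OrdConnected) (hI' : I.Nontrivial) :
    UniqueDiffOn ℝ I := by
  refine uniqueDiffOn_convex hI.convex ?_
  obtain ⟨a, ha, b, hb, hab⟩ := hI'.exists_lt
  refine ⟨(a + b) / 2, interior_mono (hI.out ha hb) ?_⟩
  rw [interior_Icc]
  constructor <;> linarith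

lemma hasDerivWithinAt_prodMk_left {f : ℝ × ℝ → ℝ} {x y : ℝ} (hy : y ∈ I)
    (hf : DifferentiableWithinAt ℝ f (I ×ˢ I) (x, y)) :
    HasDerivWithinAt (fun u => f (u, y)) (fderivWithin ℝ f (I ×ˢ I) (x, y) (1, 0)) I x := by
  have h : HasDerivWithinAt (fun u : ℝ => (u, y)) ((1 : ℝ), (0 : ℝ)) I x :=
    (hasDerivWithinAt_id x I).prodMk (hasDerivWithinAt_const x I y)
  have hm : Set.MapsTo (fun u : ℝ => (u, y)) I (I ×ˢ I) := fun u hu => ⟨hu, hy⟩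
  exact hf.hasFDerivWithinAt.comp_hasDerivWithinAt x h hm

lemma hasDerivWithinAt_prodMk_right {f : ℝ × ℝ → ℝ} {x y : ℝ} (hx : x ∈ I)
    (hf : DifferentiableWithinAt ℝ f (I ×ˢ I) (x, y)) :
    HasDerivWithinAt (fun v => f (x, v)) (fderivWithin ℝ f (I ×ˢ I) (x, y) (0, 1)) I y := by
  have h : HasDerivWithinAt (fun v : ℝ => (x, v)) ((0 : ℝ), (1 : ℝ)) I y :=
    (hasDerivWithinAt_const y I x).prodMk (hasDerivWithinAt_id y I)
  have hm : Set.MapsTo (fun v : ℝ => (x, v)) I (I ×ˢ I) := fun v hv => ⟨hx, hv⟩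
  exact hf.hasFDerivWithinAt.comp_hasDerivWithinAt y h hm

/-- The analytic consequences of twice continuous differentiability of `k` on `I × I`. -/
structure HasMixedPartials (I : Set ℝ) (k : ℝ → ℝ → ℝ) : Prop where
  hasDerivWithinAt_partialY : ∀ x ∈ I, ∀ y ∈ I,
    HasDerivWithinAt (fun v => k x v) (partialY I k x y) I y
  hasDerivWithinAt_partialXY : ∀ x ∈ I, ∀ y ∈ I,
    HasDerivWithinAt (fun u => partialY I k u y) (partialXY I k x y) I x
  continuousOn_partialXY : ContinuousOn (fun p : ℝ × ℝ => partialXY I k p.1 p.2) (I ×ˢ I)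

lemma hasMixedPartials_of_contDiffOn (hI : UniqueDiffOn ℝ I)
    (hk : ContDiffOn ℝ 2 (fun p : ℝ × ℝ => k p.1 p.2) (I ×ˢ I)) : HasMixedPartials I k := by
  have hII : UniqueDiffOn ℝ (I ×ˢ I) := hI.prod hI
  set f : ℝ × ℝ → ℝ := fun p => k p.1 p.2 with hf
  set g : ℝ × ℝ → ℝ := fun p => fderivWithin ℝ f (I ×ˢ I) p (0, 1) with hg
  have hg1 : ContDiffOn ℝ 1 g (I ×ˢ I) :=
    (hk.fderivWithin hII (m := 1) (by norm_num)).clm_apply contDiffOn_const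
  have hY : ∀ x ∈ I, ∀ y ∈ I, HasDerivWithinAt (fun v => k x v) (g (x, y)) I y :=
    fun x hx y hy => hasDerivWithinAt_prodMk_right hx
      (hk.differentiableOn (by norm_num) (x, y) ⟨hx, hy⟩)
  have hY' : ∀ x ∈ I, ∀ y ∈ I, partialY I k x y = g (x, y) :=
    fun x hx y hy => (hY x hx y hy).derivWithin (hI y hy)
  have hX : ∀ x ∈ I, ∀ y ∈ I, HasDerivWithinAt (fun u => partialY I k u y)
      (fderivWithin ℝ g (I ×ˢ I) (x, y) (1, 0)) I x := fun x hx y hy =>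
    (hasDerivWithinAt_prodMk_left hy (hg1.differentiableOn (by norm_num) (x, y) ⟨hx, hy⟩)).congr
      (fun u hu => hY' u hu y hy) (hY' x hx y hy)
  have hX' : ∀ x ∈ I, ∀ y ∈ I,
      partialXY I k x y = fderivWithin ℝ g (I ×ˢ I) (x, y) (1, 0) :=
    fun x hx y hy => (hX x hx y hy).derivWithin (hI x hx)
  refine ⟨fun x hx y hy => ?_, fun x hx y hy => ?_, ?_⟩
  · rw [hY' x hx y hy]; exact hY x hx y hy
  · rw [hX' x hx y hy]; exact hX x hx y hy
  · refine ContinuousOn.congr ?_ fun p hp => hX' p.1 hp.1 p.2 hp.2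
    exact (hg1.continuousOn_fderivWithin hII (by norm_num)).clm_apply continuousOn_const

/-- Mean value theorem on an interval, for derivatives within the interval. -/
lemma exists_uIcc_sub_eq_mul (hI : I.OrdConnected) {f f' : ℝ → ℝ}
    (hf : ∀ x ∈ I, HasDerivWithinAt f (f' x) I x) {s t : ℝ} (hs : s ∈ I) (ht : t ∈ I) :
    ∃ ξ ∈ Set.uIcc s t, f s - f t = f' ξ * (s - t) := by
  have key : ∀ a ∈ I, ∀ b ∈ I, a < b → ∃ ξ ∈ Set.Icc a b, f b - f a = f' ξ * (b - a) := by
    intro a ha b hb hab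
    have hsub : Set.Icc a b ⊆ I := hI.out ha hb
    obtain ⟨c, hc, h⟩ := exists_hasDerivAt_eq_slope f f' hab
      (fun x hx => ((hf x (hsub hx)).continuousWithinAt).mono hsub)
      (fun x hx => (hf x (hsub (Set.Ioo_subset_Icc_self hx))).hasDerivAt
        (mem_of_superset (Icc_mem_nhds hx.1 hx.2) hsub))
    refine ⟨c, Set.Ioo_subset_Icc_self hc, ?_⟩
    rw [h, div_mul_cancel₀ _ (sub_ne_zero.2 hab.ne')]
  rcases lt_trichotomy s t with h | rfl | h
  · obtain ⟨ξ, hξ, e⟩ := key s hs t ht h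
    exact ⟨ξ, by rwa [Set.uIcc_of_le h.le], by linarith⟩
  · exact ⟨s, by simp, by simp⟩
  · obtain ⟨ξ, hξ, e⟩ := key t ht s hs h
    exact ⟨ξ, by rwa [Set.uIcc_of_ge h.le], e⟩

/-- Mean value theorem for mixed second differences. -/
lemma HasMixedPartials.exists_uIcc_second_difference_eq (h : HasMixedPartials I k)
    (hI : I.OrdConnected) {s t u v : ℝ} (hs : s ∈ I) (ht : t ∈ I) (hu : u ∈ I) (hv : v ∈ I) :
    ∃ ξ ∈ Set.uIcc s t, ∃ η ∈ Set.uIcc u v,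
      k s u - k s v - k t u + k t v = partialXY I k ξ η * (s - t) * (u - v) := by
  -- The second difference is a first difference in `y` of `k s · - k t ·`; the second application
  -- is in `x`, at the fixed `η`.
  obtain ⟨η, hη, e⟩ := exists_uIcc_sub_eq_mul hI (f := fun y => k s y - k t y)
    (f' := fun y => partialY I k s y - partialY I k t y)
    (fun y hy => (h.hasDerivWithinAt_partialY s hs y hy).sub
      (h.hasDerivWithinAt_partialY t ht y hy)) hu hv
  have hηI : η ∈ I := hI.uIcc_subset hu hv hη
  obtain ⟨ξ, hξ, e'⟩ := exists_uIcc_sub_eq_mul hI (f := fun x => partialY I k x η)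
    (f' := fun x => partialXY I k x η)
    (fun x hx => h.hasDerivWithinAt_partialXY x hx η hηI) hs ht
  refine ⟨ξ, hξ, η, hη, ?_⟩
  rw [← e', ← e]
  ring

/-- Mixed difference quotients converge to the mixed partial derivative on the diagonal. -/
lemma HasMixedPartials.tendsto_second_difference (h : HasMixedPartials I k)
    (hI : I.OrdConnected) {t : ℝ} (ht : t ∈ I) :
    Tendsto (fun p : ℝ × ℝ =>
        (k p.1 p.2 - k p.1 t - k t p.2 + k t t) / ((p.1 - t) * (p.2 - t)))
      (𝓝[I \ {t}] t ×ˢ 𝓝[I \ {t}] t) (𝓝 (partialXY I k t t)) := by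
  rw [Metric.tendsto_nhds]
  intro ε hε
  obtain ⟨δ, hδ, H⟩ := Metric.continuousWithinAt_iff.1
    (h.continuousOn_partialXY (t, t) ⟨ht, ht⟩) ε hε
  have hev : ∀ᶠ s in 𝓝[I \ {t}] t, s ∈ I ∧ s ≠ t ∧ dist s t < δ := by
    filter_upwards [self_mem_nhdsWithin, mem_nhdsWithin_of_mem_nhds (Metric.ball_mem_nhds t hδ)]
      with s hs hs'
    exact ⟨hs.1, hs.2, hs'⟩
  filter_upwards [hev.prod_mk hev] with p hp
  obtain ⟨⟨h1, h1', h1''⟩, h2, h2', h2''⟩ := hp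
  obtain ⟨ξ, hξ, η, hη, e⟩ := h.exists_uIcc_second_difference_eq hI h1 ht h2 ht
  rw [e, mul_assoc, mul_div_cancel_right₀ _
    (mul_ne_zero (sub_ne_zero.2 h1') (sub_ne_zero.2 h2'))]
  have hd : ∀ {a b : ℝ}, b ∈ Set.uIcc a t → dist a t < δ → dist b t < δ := fun hb hab => by
    refine lt_of_le_of_lt ?_ hab
    rw [Real.dist_eq, Real.dist_eq, abs_sub_comm _ t, abs_sub_comm _ t]
    exact Set.abs_sub_right_of_mem_uIcc hb
  refine H (x := (ξ, η)) ⟨hI.uIcc_subset h1 ht hξ, hI.uIcc_subset h2 ht hη⟩ ?_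
  rw [Prod.dist_eq, max_lt_iff]
  exact ⟨hd hξ h1'', hd hη h2''⟩

end Calculus

/-! ### Hilbert-space curves with a prescribed Gram kernel. -/

section FeatureMap

open scoped RealInnerProductSpace

variable {I : Set ℝ} {k : ℝ → ℝ → ℝ} {H : Type*} [NormedAddCommGroup H] [InnerProductSpace ℝ H]
  {φ φ' : ℝ → H}

lemma tendsto_inner_slope_slope (h : HasMixedPartials I k) (hI : I.OrdConnected)
    (hφ : ∀ s ∈ I, ∀ t ∈ I, ⟪φ s, φ t⟫ = k s t) {t : ℝ} (ht : t ∈ I) :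
    Tendsto (fun p : ℝ × ℝ => ⟪slope φ t p.1, slope φ t p.2⟫)
      (𝓝[I \ {t}] t ×ˢ 𝓝[I \ {t}] t) (𝓝 (partialXY I k t t)) := by
  refine (h.tendsto_second_difference hI ht).congr' ?_
  have hev : ∀ᶠ s in 𝓝[I \ {t}] t, s ∈ I := by
    filter_upwards [self_mem_nhdsWithin] with s hs using hs.1
  filter_upwards [hev.prod_mk hev] with p hp
  simp only [slope_def_module, real_inner_smul_left, real_inner_smul_right, inner_sub_left,
    inner_sub_right, hφ _ hp.1 _ hp.2, hφ _ hp.1 _ ht, hφ _ ht _ hp.2, hφ _ ht _ ht]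
  rw [div_eq_mul_inv, mul_inv]
  ring

/-- Expanding `‖a - b‖² = ⟪a, a⟫ - 2⟪a, b⟫ + ⟪b, b⟫` for two slopes, all three inner products tend
to the same limit, so the slopes are Cauchy. -/
lemma exists_hasDerivWithinAt_of_inner_eq [CompleteSpace H] (h : HasMixedPartials I k)
    (hI : I.OrdConnected) (hI' : UniqueDiffOn ℝ I)
    (hφ : ∀ s ∈ I, ∀ t ∈ I, ⟪φ s, φ t⟫ = k s t) {t : ℝ} (ht : t ∈ I) :
    ∃ ψ, HasDerivWithinAt φ ψ I t := by
  have : (𝓝[I \ {t}] t).NeBot :=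
    accPt_principal_iff_nhdsWithin.1 (uniqueDiffWithinAt_iff_accPt.1 (hI' t ht))
  have hq := tendsto_inner_slope_slope h hI hφ ht
  have hdiag : Tendsto (fun s => ⟪slope φ t s, slope φ t s⟫) (𝓝[I \ {t}] t)
      (𝓝 (partialXY I k t t)) := hq.comp (tendsto_id.prodMk tendsto_id)
  have hsub : Tendsto (fun p : ℝ × ℝ => dist (slope φ t p.1) (slope φ t p.2) ^ 2)
      (𝓝[I \ {t}] t ×ˢ 𝓝[I \ {t}] t) (𝓝 0) := by
    have := ((hdiag.comp tendsto_fst).sub (hq.const_mul 2)).add (hdiag.comp tendsto_snd)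
    convert this using 2
    · rw [dist_eq_norm, norm_sub_sq_real]
      simp
    · ring
  have hdist : Tendsto (fun p : ℝ × ℝ => dist (slope φ t p.1) (slope φ t p.2))
      (𝓝[I \ {t}] t ×ˢ 𝓝[I \ {t}] t) (𝓝 0) := by
    simpa [Real.sqrt_sq dist_nonneg] using hsub.sqrt
  have hc : Cauchy (map (slope φ t) (𝓝[I \ {t}] t)) := by
    rw [cauchy_map_iff]
    refine ⟨inferInstance, ?_⟩
    rw [Metric.uniformity_eq_comap_nhds_zero, tendsto_comap_iff]
    exact hdist
  obtain ⟨ψ, hψ⟩ := CompleteSpace.complete hc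
  exact ⟨ψ, hasDerivWithinAt_iff_tendsto_slope.2 hψ⟩

lemma inner_deriv_right (hI' : UniqueDiffOn ℝ I)
    (h : HasMixedPartials I k) (hφ : ∀ s ∈ I, ∀ t ∈ I, ⟪φ s, φ t⟫ = k s t)
    {s t : ℝ} (hs : s ∈ I) (ht : t ∈ I) {ψ : H} (hψ : HasDerivWithinAt φ ψ I t) :
    ⟪φ s, ψ⟫ = partialY I k s t := by
  have h1 : HasDerivWithinAt (fun v => ⟪φ s, φ v⟫) ⟪φ s, ψ⟫ I t := by
    simpa using (hasDerivWithinAt_const t I (φ s)).inner ℝ hψ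
  exact (hI' t ht).eq_deriv _ (h1.congr_of_mem (fun v hv => (hφ s hs v hv).symm) ht)
    (h.hasDerivWithinAt_partialY s hs t ht)

lemma inner_deriv_deriv (hI' : UniqueDiffOn ℝ I)
    (h : HasMixedPartials I k) (hφ : ∀ s ∈ I, ∀ t ∈ I, ⟪φ s, φ t⟫ = k s t)
    {s t : ℝ} (hs : s ∈ I) (ht : t ∈ I) {χ ψ : H} (hχ : HasDerivWithinAt φ χ I s)
    (hψ : HasDerivWithinAt φ ψ I t) :
    ⟪χ, ψ⟫ = partialXY I k s t := by
  have h1 : HasDerivWithinAt (fun v => ⟪φ v, ψ⟫) ⟪χ, ψ⟫ I s := by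
    simpa using hχ.inner ℝ (hasDerivWithinAt_const s I ψ)
  exact (hI' s hs).eq_deriv _
    (h1.congr_of_mem (fun v hv => (inner_deriv_right hI' h hφ hv ht hψ).symm) hs)
    (h.hasDerivWithinAt_partialXY s hs t ht)

/-- If `ψ` is the derivative at `t`, then `⟪ψ, ψ⟫`, `⟪ψ, φ' t⟫` and `⟪φ' t, φ' t⟫` all equal
`∂²k/∂x∂y (t, t)`, so `‖ψ - φ' t‖² = 0`. -/
lemma hasDerivWithinAt_of_inner_eq [CompleteSpace H] (h : HasMixedPartials I k)
    (hI : I.OrdConnected) (hI' : UniqueDiffOn ℝ I)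
    (hφ : ∀ s ∈ I, ∀ t ∈ I, ⟪φ s, φ t⟫ = k s t)
    (hφ' : ∀ s ∈ I, ∀ t ∈ I, ⟪φ s, φ' t⟫ = partialY I k s t)
    (hφ'' : ∀ s ∈ I, ∀ t ∈ I, ⟪φ' s, φ' t⟫ = partialXY I k s t) {t : ℝ} (ht : t ∈ I) :
    HasDerivWithinAt φ (φ' t) I t := by
  obtain ⟨ψ, hψ⟩ := exists_hasDerivWithinAt_of_inner_eq h hI hI' hφ ht
  have h1 : ⟪ψ, ψ⟫ = partialXY I k t t := inner_deriv_deriv hI' h hφ ht ht hψ hψ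
  have h2 : ⟪ψ, φ' t⟫ = partialXY I k t t := by
    have h3 : HasDerivWithinAt (fun v => ⟪φ v, φ' t⟫) ⟪ψ, φ' t⟫ I t := by
      simpa using hψ.inner ℝ (hasDerivWithinAt_const t I (φ' t))
    exact (hI' t ht).eq_deriv _ (h3.congr_of_mem (fun v hv => (hφ' v hv t ht).symm) ht)
      (h.hasDerivWithinAt_partialXY t ht t ht)
  have h0 : ψ = φ' t := by
    rw [← sub_eq_zero, ← inner_self_eq_zero (𝕜 := ℝ), inner_sub_left, inner_sub_right,
      inner_sub_right, h1, h2, hφ'' t ht t ht, real_inner_comm, h2]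
    ring
  exact h0 ▸ hψ

lemma continuousOn_of_inner_eq {K : ℝ → ℝ → ℝ}
    (hK : ContinuousOn (fun p : ℝ × ℝ => K p.1 p.2) (I ×ˢ I))
    (hφ : ∀ s ∈ I, ∀ t ∈ I, ⟪φ s, φ t⟫ = K s t) : ContinuousOn φ I := by
  intro t ht
  have h1 : ContinuousWithinAt (fun s => K s s) I t :=
    (hK (t, t) ⟨ht, ht⟩).comp (f := fun s : ℝ => (s, s)) (by fun_prop) fun s hs => ⟨hs, hs⟩
  have h2 : ContinuousWithinAt (fun s => K s t) I t :=
    (hK (t, t) ⟨ht, ht⟩).comp (f := fun s : ℝ => (s, t)) (by fun_prop) fun s hs => ⟨hs, ht⟩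
  have h3 : Tendsto (fun s => K s s - 2 * K s t + K t t) (𝓝[I] t) (𝓝 0) := by
    have := (h1.tendsto.sub (h2.tendsto.const_mul 2)).add_const (K t t)
    convert this using 2
    ring
  rw [ContinuousWithinAt, tendsto_iff_norm_sub_tendsto_zero]
  have h4 : Tendsto (fun s => ‖φ s - φ t‖ ^ 2) (𝓝[I] t) (𝓝 0) := by
    refine h3.congr' ?_
    filter_upwards [self_mem_nhdsWithin] with s hs
    rw [norm_sub_sq_real, hφ s hs t ht, ← real_inner_self_eq_norm_sq, ← real_inner_self_eq_norm_sq,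
      hφ s hs s hs, hφ t ht t ht]
  simpa [Real.sqrt_sq (norm_nonneg _)] using h4.sqrt

end FeatureMap

/-- A positive semi-definite kernel has a feature map into a Hilbert space. -/
lemma exists_feature_map {X : Type} (k : X → X → ℝ) (hsymm : ∀ s t, k s t = k t s)
    (hnonneg : ∀ (n : ℕ) (t : Fin n → X) (c : Fin n → ℝ),
      0 ≤ ∑ i, ∑ j, c i * c j * k (t i) (t j)) :
    ∃ (H : Type) (_ : NormedAddCommGroup H) (_ : InnerProductSpace ℝ H) (_ : CompleteSpace H)
      (φ : X → H), ∀ s t, inner ℝ (φ s) (φ t) = k s t := by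
  -- The reproducing kernel space is built from operator-valued kernels; a scalar acts by
  -- multiplication.
  let K : Matrix X X (ℝ →L[ℝ] ℝ) := .of fun x y => k x y • 1
  have hK : K.PosSemidef := by
    have htfae := (RKHS.posSemidef_tfae (K := K)).out 0 2
    refine htfae.2 ⟨?_, fun v => ?_⟩
    · ext x y
      simp [K, Matrix.conjTranspose_apply, hsymm x y, star_smul]
    · have e := v.support.equivFin
      have := hnonneg v.support.card (fun i => (e.symm i : X)) (fun i => v (e.symm i))
      rw [e.symm.sum_comp (fun i : v.support => ∑ j, v i * v (e.symm j) * k i (e.symm j))] at this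
      simp_rw [fun i : v.support => e.symm.sum_comp (fun j : v.support => v i * v j * k i j)]
        at this
      simp only [Finsupp.sum, K]
      refine this.trans_eq ?_
      rw [Finset.sum_coe_sort v.support (fun i => ∑ j : v.support, v i * v j * k i j)]
      refine Finset.sum_congr rfl fun i _ => ?_
      rw [Finset.sum_coe_sort v.support (fun j => v i * v j * k i j)]
      refine (map_sum (RCLike.re : ℝ →+ ℝ) _ _).symm ▸ Finset.sum_congr rfl fun j _ => ?_
      change v i * v j * k i j = v j * (k j i * v i)
      rw [hsymm j i]
      ring
  have : Fact K.PosSemidef := ⟨hK⟩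
  refine ⟨RKHS.OfKernel K, inferInstance, inferInstance, inferInstance,
    fun x => RKHS.kerFun (RKHS.OfKernel K) x 1, fun s t => ?_⟩
  rw [← RKHS.kernel_inner, RKHS.OfKernel.kernel_ofKernel]
  simp [K, hsymm s t]

/-! ### Isometric embedding of a Hilbert space as centred Gaussian variables. -/

section Isonormal

open scoped RealInnerProductSpace

variable {Ω : Type*} [MeasurableSpace Ω] {P : Measure Ω}

lemma integral_sq_eq_norm_sq (f : Lp ℝ 2 P) : ∫ ω, f ω ^ 2 ∂P = ‖f‖ ^ 2 := by
  rw [← real_inner_self_eq_norm_sq, L2.inner_def]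
  simp [sq]

/-- For a centred variable the variance is the squared `L²` norm. Both sides are continuous in `f`,
so the identity passes to `L²` limits. -/
lemma integral_cexp_of_hasGaussianLaw {f : Lp ℝ 2 P} (hf : HasGaussianLaw f P)
    (h0 : ∫ ω, f ω ∂P = 0) :
    ∫ ω, Complex.exp (Complex.I * f ω) ∂P = Complex.exp (-(‖f‖ ^ 2 / 2 : ℝ)) := by
  have h1 : charFun (P.map f) 1 = ∫ ω, Complex.exp (Complex.I * f ω) ∂P := by
    rw [charFun_apply_real, integral_map hf.aemeasurable (by fun_prop)]
    simp [mul_comm]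
  have hv : Var[f; P] = ‖f‖ ^ 2 := by
    rw [variance_of_integral_eq_zero hf.aemeasurable h0, ← integral_sq_eq_norm_sq]
  rw [← h1, hf.map_eq_gaussianReal, charFun_gaussianReal, h0, hv,
    Real.coe_toNNReal _ (sq_nonneg _)]
  congr 1
  push_cast
  ring

variable [IsProbabilityMeasure P]

lemma norm_cexp_I_mul_sub_le (x y : ℝ) :
    ‖Complex.exp (Complex.I * x) - Complex.exp (Complex.I * y)‖ ≤ |x - y| := by
  have h : Complex.exp (Complex.I * x) - Complex.exp (Complex.I * y)
      = Complex.exp (Complex.I * y) * (Complex.exp (Complex.I * ((x - y : ℝ) : ℂ)) - 1) := by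
    rw [mul_sub, ← Complex.exp_add]
    congr 2
    · push_cast; ring
    · ring
  rw [h, norm_mul, Complex.norm_exp_I_mul_ofReal, one_mul]
  exact Real.norm_exp_I_mul_ofReal_sub_one_le

lemma integrable_cexp_I_mul {f : Ω → ℝ} (hf : AEStronglyMeasurable f P) :
    Integrable (fun ω => Complex.exp (Complex.I * f ω)) P := by
  refine Integrable.of_bound (C := 1) ?_ ?_
  · exact Complex.continuous_exp.comp_aestronglyMeasurable
      ((Complex.continuous_ofReal.comp_aestronglyMeasurable hf).const_mul _)
  · exact ae_of_all _ fun ω => (Complex.norm_exp_I_mul_ofReal _).le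

/-- The value at `1` of the characteristic function is Lipschitz on `L²`. -/
lemma lipschitzWith_integral_cexp :
    LipschitzWith 1 (fun f : Lp ℝ 2 P => ∫ ω, Complex.exp (Complex.I * f ω) ∂P) := by
  refine LipschitzWith.of_dist_le_mul fun f g => ?_
  rw [dist_eq_norm, ← integral_sub (integrable_cexp_I_mul (Lp.aestronglyMeasurable f))
    (integrable_cexp_I_mul (Lp.aestronglyMeasurable g)), NNReal.coe_one, one_mul, Lp.dist_def]
  have hfg : MemLp (⇑f - ⇑g) 2 P := (Lp.memLp f).sub (Lp.memLp g)
  calc ‖∫ ω, (Complex.exp (Complex.I * f ω) - Complex.exp (Complex.I * g ω)) ∂P‖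
      ≤ ∫ ω, ‖(⇑f - ⇑g) ω‖ ∂P :=
        norm_integral_le_of_norm_le (hfg.integrable (by norm_num)).norm
          (ae_of_all _ fun ω => norm_cexp_I_mul_sub_le _ _)
    _ = (eLpNorm (⇑f - ⇑g) 1 P).toReal := by
        rw [eLpNorm_one_eq_lintegral_enorm, integral_norm_eq_lintegral_enorm hfg.1]
    _ ≤ (eLpNorm (⇑f - ⇑g) 2 P).toReal :=
        ENNReal.toReal_mono hfg.2.ne
          (eLpNorm_le_eLpNorm_of_exponent_le (by norm_num) hfg.1)

/-- The characteristic function of `f` at `c` is that of `c • f` at `1`. -/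
lemma map_eq_gaussianReal_of_integral_cexp {f : Lp ℝ 2 P}
    (hf : ∀ c : ℝ, ∫ ω, Complex.exp (Complex.I * (c • f) ω) ∂P
      = Complex.exp (-(‖c • f‖ ^ 2 / 2 : ℝ))) :
    P.map f = gaussianReal 0 (‖f‖₊ ^ 2) := by
  have hm : AEMeasurable f P := (Lp.aestronglyMeasurable f).aemeasurable
  have := Measure.isProbabilityMeasure_map hm
  refine Measure.ext_of_charFun (funext fun c => ?_)
  rw [charFun_gaussianReal, charFun_apply_real, integral_map hm (by fun_prop)]
  have h1 : ∫ ω, Complex.exp (c * f ω * Complex.I) ∂P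
      = ∫ ω, Complex.exp (Complex.I * (c • f) ω) ∂P := by
    refine integral_congr_ae ?_
    filter_upwards [Lp.coeFn_smul c f] with ω hω
    rw [hω]
    simp only [Pi.smul_apply, smul_eq_mul]
    push_cast
    ring_nf
  rw [h1, hf c, norm_smul]
  congr 1
  simp only [mul_pow, Real.norm_eq_abs, sq_abs]
  push_cast
  ring

/-- Every real Hilbert space embeds isometrically into an `L²` space of a probability space, as a
space of centered Gaussian random variables. -/
lemma exists_isonormal (H : Type) [NormedAddCommGroup H] [InnerProductSpace ℝ H]
    [CompleteSpace H] :
    ∃ (Ω : Type) (_ : MeasurableSpace Ω) (P : Measure Ω) (_ : IsProbabilityMeasure P)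
      (W : H →ₗᵢ[ℝ] Lp ℝ 2 P), ∀ h, P.map (W h) = gaussianReal 0 (‖h‖₊ ^ 2) := by
  classical
  obtain ⟨w, b, -⟩ := exists_hilbertBasis ℝ H
  let P : Measure (w → ℝ) := Measure.infinitePi fun _ => gaussianReal 0 1
  have hlaw : ∀ i, HasLaw (fun ω : w → ℝ => ω i) (gaussianReal 0 1) P := fun i =>
    (measurePreserving_eval_infinitePi (fun _ : w => gaussianReal 0 1) i).hasLaw
  have hind : iIndepFun (fun i (ω : w → ℝ) => ω i) P :=
    iIndepFun_infinitePi (P := fun _ : w => gaussianReal 0 1) (X := fun _ x => x)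
      fun _ => measurable_id
  have hgp : IsGaussianProcess (fun i (ω : w → ℝ) => ω i) P :=
    ⟨fun s => iIndepFun.hasGaussianLaw (fun i => (hlaw i).hasGaussianLaw)
      (hind.precomp Subtype.val_injective)⟩
  have hint : ∀ i, ∫ ω, ω i ∂P = 0 := fun i => by
    rw [(hlaw i).integral_eq, integral_id_gaussianReal]
  have hL : ∀ i, MemLp (fun ω : w → ℝ => ω i) 2 P := fun i =>
    (hgp.hasGaussianLaw_eval i).memLp_two
  let X : w → Lp ℝ 2 P := fun i => (hL i).toLp
  have hinner : ∀ i j, ⟪X i, X j⟫ = ∫ ω, ω j * ω i ∂P := fun i j => by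
    rw [L2.inner_def]
    refine integral_congr_ae ?_
    filter_upwards [(hL i).coeFn_toLp, (hL j).coeFn_toLp] with ω h1 h2
    simp [X, h1, h2]
  have hX : Orthonormal ℝ X := by
    rw [orthonormal_iff_ite]
    intro i j
    rw [hinner]
    split_ifs with h
    · subst h
      have : Var[fun ω : w → ℝ => ω i; P] = 1 := by
        rw [(hlaw i).variance_eq, variance_id_gaussianReal, NNReal.coe_one]
      rw [variance_of_integral_eq_zero (measurable_pi_apply i).aemeasurable (hint i)] at this
      simpa [sq] using this
    · have := (hind.indepFun (Ne.symm h)).integral_mul_eq_mul_integral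
        (hL j).aestronglyMeasurable (hL i).aestronglyMeasurable
      simpa [hint] using this
  let U := hX.orthogonalFamily.linearIsometry
  let W : H →ₗᵢ[ℝ] Lp ℝ 2 P := U.comp b.repr.toLinearIsometry
  -- `W h` is an `L²` limit of finite combinations of independent Gaussians. These lie in the closed
  -- set `G`, hence so does `W h`.
  let G : Set (Lp ℝ 2 P) := {f | ∫ ω, Complex.exp (Complex.I * f ω) ∂P
    = Complex.exp (-(‖f‖ ^ 2 / 2 : ℝ))}
  have hG : IsClosed G :=
    isClosed_eq lipschitzWith_integral_cexp.continuous (by fun_prop)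
  have hWG : ∀ h, W h ∈ G := by
    intro h
    have hs : HasSum (fun i => b.repr h i • X i) (W h) := by
      have := hX.orthogonalFamily.hasSum_linearIsometry (b.repr h)
      simp only [LinearIsometry.toSpanSingleton_apply] at this
      exact this
    refine hG.mem_of_tendsto hs (Eventually.of_forall fun s => ?_)
    have hae : ⇑(∑ i ∈ s, b.repr h i • X i) =ᵐ[P] fun ω => ∑ i ∈ s, b.repr h i • ω i := by
      have h1 : ∀ᵐ ω ∂P, ∀ i ∈ s, (b.repr h i • X i : Lp ℝ 2 P) ω = b.repr h i • ω i := by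
        rw [Finset.eventually_all]
        intro i _
        filter_upwards [Lp.coeFn_smul (b.repr h i) (X i), (hL i).coeFn_toLp] with ω h1 h2
        rw [h1, Pi.smul_apply, h2]
      filter_upwards [Lp.coeFn_finsetSum s fun i => b.repr h i • X i, h1] with ω h2 h3
      rw [h2, Finset.sum_apply]
      exact Finset.sum_congr rfl h3
    have hgauss := (hgp.smul fun i => b.repr h i).hasGaussianLaw_fun_sum (I := s)
    refine integral_cexp_of_hasGaussianLaw (hgauss.congr hae.symm) ?_
    rw [integral_congr_ae hae]
    refine (integral_finsetSum s fun i _ =>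
      ((hL i).integrable (by norm_num)).smul (b.repr h i)).trans ?_
    refine Finset.sum_eq_zero fun i _ => ?_
    exact (integral_smul _ _).trans (by rw [hint i, smul_zero (b.repr h i)])
  refine ⟨w → ℝ, inferInstance, P, inferInstance, W, fun h => ?_⟩
  rw [map_eq_gaussianReal_of_integral_cexp, W.nnnorm_map]
  intro c
  rw [← map_smul]
  exact hWG _

end Isonormal

/-! ### Construction of a derivative Gaussian process. -/

section Existence

lemma exists_isDGP {I : Set ℝ} (hI : I.OrdConnected) (hI' : UniqueDiffOn ℝ I)
    {k : ℝ → ℝ → ℝ} (hk : IsKernelOn I k) (h : HasMixedPartials I k) (m : ℝ → ℝ) :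
    ∃ (Ω : Type) (_ : MeasurableSpace Ω) (P : Measure Ω) (_ : IsProbabilityMeasure P)
      (D : I → Ω → ℝ × ℝ), IsDGP I m k D P := by
  classical
  obtain ⟨H, _, _, _, φ₀, hφ₀⟩ := exists_feature_map (fun s t : I => k s t)
    (fun s t => hk.symm s s.2 t t.2) hk.nonneg
  let φ : ℝ → H := fun t => if ht : t ∈ I then φ₀ ⟨t, ht⟩ else 0
  have hφ : ∀ s ∈ I, ∀ t ∈ I, inner ℝ (φ s) (φ t) = k s t := fun s hs t ht => by
    simp [φ, hs, ht, hφ₀]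
  choose! ψ hψ using fun t (ht : t ∈ I) => exists_hasDerivWithinAt_of_inner_eq h hI hI' hφ ht
  obtain ⟨Ω, _, P, _, W, hW⟩ := exists_isonormal H
  have hWm : ∀ x, Measurable (W x) := fun x => (Lp.stronglyMeasurable (W x)).measurable
  have hW0 : ∀ x, ∫ ω, W x ω ∂P = 0 := fun x => by
    have : HasLaw (W x) (gaussianReal 0 (‖x‖₊ ^ 2)) P := ⟨(hWm x).aemeasurable, hW x⟩
    rw [this.integral_eq, integral_id_gaussianReal]
  have hWi : ∀ x, Integrable (W x) P := fun x => (Lp.memLp (W x)).integrable (by norm_num)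
  have hmean : ∀ (a : ℝ) x, ∫ ω, (a + W x ω) ∂P = a := fun a x => by
    rw [integral_add (integrable_const a) (hWi x), hW0]
    simp
  have hcov : ∀ (a b : ℝ) x y,
      cov[fun ω => a + W x ω, fun ω => b + W y ω; P] = inner ℝ x y := fun a b x y => by
    rw [← W.inner_map_map, L2.inner_def, covariance]
    simp [hmean, mul_comm]
  -- By linearity of `W`, a linear functional of this vector is a.e. one `W y` plus a constant,
  -- hence Gaussian.
  have hcomb : ∀ {ι : Type} [Fintype ι] (a : ι → ℝ) (x : ι → H),
      HasGaussianLaw (fun ω i => a i + W (x i) ω) P := by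
    intro ι _ a x
    have hmeas : Measurable (fun ω i => a i + W (x i) ω) :=
      measurable_pi_lambda _ fun i => (hWm (x i)).const_add (a i)
    refine ⟨⟨fun L => ?_⟩⟩
    let c : ι → ℝ := fun i => L (Pi.single i 1)
    have hL : ∀ v : ι → ℝ, L v = ∑ i, c i * v i := fun v => by
      conv_lhs => rw [← Finset.univ_sum_single v, map_sum]
      refine Finset.sum_congr rfl fun i _ => ?_
      have : (Pi.single i (v i) : ι → ℝ) = v i • Pi.single i 1 := by
        rw [← Pi.single_smul, smul_eq_mul, mul_one]
      rw [this, map_smul, smul_eq_mul, mul_comm]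
    have hae : (fun ω => L fun i => a i + W (x i) ω)
        =ᵐ[P] fun ω => W (∑ i, c i • x i) ω + ∑ i, c i * a i := by
      have h1 : ∀ᵐ ω ∂P, ∀ i, (c i • W (x i)) ω = c i * W (x i) ω := by
        rw [ae_all_iff]
        intro i
        filter_upwards [Lp.coeFn_smul (c i) (W (x i))] with ω h1
        rw [h1, Pi.smul_apply, smul_eq_mul]
      filter_upwards [Lp.coeFn_finsetSum Finset.univ fun i => c i • W (x i), h1] with ω h2 h3
      simp only [map_sum, map_smul]
      rw [h2, Finset.sum_apply, hL, ← Finset.sum_add_distrib]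
      refine Finset.sum_congr rfl fun i _ => ?_
      rw [h3]
      ring
    have hg : HasGaussianLaw (fun ω => L fun i => a i + W (x i) ω) P := by
      have hlaw : HasLaw (W (∑ i, c i • x i)) (gaussianReal 0 (‖∑ i, c i • x i‖₊ ^ 2)) P :=
        ⟨(hWm _).aemeasurable, hW _⟩
      exact (gaussianReal_add_const hlaw (∑ i, c i * a i)).hasGaussianLaw.congr hae.symm
    rw [Measure.map_map (by fun_prop) hmeas, integral_map hmeas.aemeasurable (by fun_prop),
      variance_map (by fun_prop) hmeas.aemeasurable]
    exact hg.map_eq_gaussianReal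
  refine ⟨Ω, inferInstance, P, inferInstance,
    fun t ω => (m t + W (φ t) ω, deriv1 I m t + W (ψ t) ω), ?_⟩
  refine ⟨fun t => ((hWm _).const_add _).prodMk ((hWm _).const_add _), fun n t => ?_,
    fun t => hmean _ _, fun t => hmean _ _, fun s t => ?_, fun s t => ?_, fun s t => ?_⟩
  · have := hcomb (ι := Fin n ⊕ Fin n)
      (Sum.elim (fun i => m (t i)) fun i => deriv1 I m (t i))
      (Sum.elim (fun i => φ (t i)) fun i => ψ (t i))
    convert this using 3 with ω i
    cases i <;> rfl
  · exact (hcov _ _ _ _).trans (hφ s s.2 t t.2)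
  · exact (hcov _ _ _ _).trans (inner_deriv_right hI' h hφ s.2 t.2 (hψ t t.2))
  · exact (hcov _ _ _ _).trans (inner_deriv_deriv hI' h hφ s.2 t.2 (hψ s s.2) (hψ t t.2))

end Existence

/-! ### Mean-square properties of an arbitrary derivative Gaussian process. -/

section Properties

variable {Ω : Type*} [MeasurableSpace Ω] {P : Measure Ω} {I : Set ℝ}
  {m : ℝ → ℝ} {k : ℝ → ℝ → ℝ} {D : I → Ω → ℝ × ℝ}

/-- Enumerating a finite index set turns its restriction into a linear image of a `Fin`-indexed
vector. -/
lemma isGaussianProcess_of_forall_fin {T : Type*} {z : T → Ω → ℝ}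
    (h : ∀ (n : ℕ) (t : Fin n → T), HasGaussianLaw (fun ω i => z (t i) ω) P) :
    IsGaussianProcess z P := by
  refine ⟨fun J => ?_⟩
  let e := J.equivFin
  have h1 := h J.card fun i => (e.symm i : T)
  have h2 := h1.map (ContinuousLinearMap.pi fun j : J =>
    ContinuousLinearMap.proj (R := ℝ) (φ := fun _ : Fin J.card => ℝ) (e j))
  have h3 : (fun ω => J.restrict fun x => z x ω) =
      (ContinuousLinearMap.pi fun j : J =>
        ContinuousLinearMap.proj (R := ℝ) (φ := fun _ : Fin J.card => ℝ) (e j)) ∘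
        fun ω i => z (e.symm i : T) ω := by
    funext ω j
    simp
  rw [h3]
  exact h2

lemma IsDGP.isGaussianProcess_fst (hD : IsDGP I m k D P) :
    IsGaussianProcess (fun t ω => (D t ω).1) P :=
  isGaussianProcess_of_forall_fin fun n t =>
    (hD.gaussian n t).map (ContinuousLinearMap.pi fun i =>
      ContinuousLinearMap.proj (R := ℝ) (φ := fun _ : Fin n ⊕ Fin n => ℝ) (Sum.inl i))

lemma IsDGP.isGaussianProcess_snd (hD : IsDGP I m k D P) :
    IsGaussianProcess (fun t ω => (D t ω).2) P :=
  isGaussianProcess_of_forall_fin fun n t =>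
    (hD.gaussian n t).map (ContinuousLinearMap.pi fun i =>
      ContinuousLinearMap.proj (R := ℝ) (φ := fun _ : Fin n ⊕ Fin n => ℝ) (Sum.inr i))

lemma IsDGP.isGP_fst (hD : IsDGP I m k D P) : IsGP I m k (fun t ω => (D t ω).1) P :=
  ⟨fun t => (hD.measurable t).fst, hD.isGaussianProcess_fst, hD.mean_fst, hD.cov_fst_fst⟩

lemma IsDGP.isGP_snd (hD : IsDGP I m k D P) :
    IsGP I (deriv1 I m) (partialXY I k) (fun t ω => (D t ω).2) P :=
  ⟨fun t => (hD.measurable t).snd, hD.isGaussianProcess_snd, hD.mean_snd, hD.cov_snd_snd⟩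

lemma inner_toLp_sub_const_one [IsProbabilityMeasure P] {X Y : Ω → ℝ} (hX : MemLp X 2 P)
    (hY : MemLp Y 2 P) :
    inner ℝ (hX.toLp - (∫ ω, X ω ∂P) • Lp.const 2 P (1 : ℝ))
      (hY.toLp - (∫ ω, Y ω ∂P) • Lp.const 2 P (1 : ℝ)) = cov[X, Y; P] := by
  rw [L2.inner_def, covariance]
  refine integral_congr_ae ?_
  filter_upwards [hX.coeFn_toLp, hY.coeFn_toLp, Lp.coeFn_const 2 P (1 : ℝ),
    Lp.coeFn_sub hX.toLp ((∫ ω, X ω ∂P) • Lp.const 2 P (1 : ℝ)),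
    Lp.coeFn_sub hY.toLp ((∫ ω, Y ω ∂P) • Lp.const 2 P (1 : ℝ)),
    Lp.coeFn_smul (∫ ω, X ω ∂P) (Lp.const 2 P (1 : ℝ)),
    Lp.coeFn_smul (∫ ω, Y ω ∂P) (Lp.const 2 P (1 : ℝ))] with ω h1 h2 h3 h4 h5 h6 h7
  rw [h4, h5, Pi.sub_apply, Pi.sub_apply, h1, h2, h6, h7, Pi.smul_apply, Pi.smul_apply, h3]
  simp [mul_comm]

/-- A DGP, viewed in `L²`, is differentiable with continuous derivative. -/
lemma IsDGP.hasDerivWithinAt_toLp [IsProbabilityMeasure P] (hI : I.OrdConnected)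
    (hI' : UniqueDiffOn ℝ I) (h : HasMixedPartials I k) (hm : ContDiffOn ℝ 1 m I)
    (hD : IsDGP I m k D P) {Z Z' : ℝ → Lp ℝ 2 P}
    (hZ : ∀ t : I, Z t =ᵐ[P] fun ω => (D t ω).1) (hZ' : ∀ t : I, Z' t =ᵐ[P] fun ω => (D t ω).2) :
    (∀ t ∈ I, HasDerivWithinAt Z (Z' t) I t) ∧ ContinuousOn Z' I := by
  have hcov : ∀ {F G : Lp ℝ 2 P} {X Y : Ω → ℝ} {a b : ℝ}, F =ᵐ[P] X → G =ᵐ[P] Y →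
      ∫ ω, X ω ∂P = a → ∫ ω, Y ω ∂P = b →
      inner ℝ (F - a • Lp.const 2 P (1 : ℝ)) (G - b • Lp.const 2 P (1 : ℝ)) = cov[X, Y; P] := by
    intro F G X Y a b hF hG ha hb
    have hX : MemLp X 2 P := (memLp_congr_ae hF).1 (Lp.memLp F)
    have hY : MemLp Y 2 P := (memLp_congr_ae hG).1 (Lp.memLp G)
    have hF' : F = hX.toLp := Lp.ext (hF.trans hX.coeFn_toLp.symm)
    have hG' : G = hY.toLp := Lp.ext (hG.trans hY.coeFn_toLp.symm)
    rw [hF', hG', ← ha, ← hb, inner_toLp_sub_const_one]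
  -- The centred curves have covariances as inner products; the smooth deterministic part is added
  -- back afterwards.
  let ζ : ℝ → Lp ℝ 2 P := fun t => Z t - m t • Lp.const 2 P (1 : ℝ)
  let ζ' : ℝ → Lp ℝ 2 P := fun t => Z' t - deriv1 I m t • Lp.const 2 P (1 : ℝ)
  have hζ'ζ' : ∀ s ∈ I, ∀ t ∈ I, inner ℝ (ζ' s) (ζ' t) = partialXY I k s t := fun s hs t ht =>
    (hcov (hZ' ⟨s, hs⟩) (hZ' ⟨t, ht⟩) (hD.mean_snd ⟨s, hs⟩) (hD.mean_snd ⟨t, ht⟩)).trans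
      (hD.cov_snd_snd ⟨s, hs⟩ ⟨t, ht⟩)
  constructor
  · intro t ht
    have h1 : HasDerivWithinAt ζ (ζ' t) I t := by
      refine hasDerivWithinAt_of_inner_eq h hI hI' (fun s hs t ht => ?_) (fun s hs t ht => ?_)
        hζ'ζ' ht
      · exact (hcov (hZ ⟨s, hs⟩) (hZ ⟨t, ht⟩) (hD.mean_fst ⟨s, hs⟩) (hD.mean_fst ⟨t, ht⟩)).trans
          (hD.cov_fst_fst ⟨s, hs⟩ ⟨t, ht⟩)
      · exact (hcov (hZ ⟨s, hs⟩) (hZ' ⟨t, ht⟩) (hD.mean_fst ⟨s, hs⟩) (hD.mean_snd ⟨t, ht⟩)).trans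
          (hD.cov_fst_snd ⟨s, hs⟩ ⟨t, ht⟩)
    have h2 : HasDerivWithinAt m (deriv1 I m t) I t :=
      (hm.differentiableOn (by norm_num) t ht).hasDerivWithinAt
    have h3 := h1.add (h2.smul_const (Lp.const 2 P (1 : ℝ)))
    rw [show ζ' t + deriv1 I m t • Lp.const 2 P (1 : ℝ) = Z' t from sub_add_cancel _ _] at h3
    exact h3.congr_of_mem (fun s _ => (sub_add_cancel _ _).symm) ht
  · have h1 : ContinuousOn ζ' I := continuousOn_of_inner_eq h.continuousOn_partialXY hζ'ζ'
    have h2 : ContinuousOn (fun t => deriv1 I m t) I :=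
      hm.continuousOn_derivWithin hI' (by norm_num)
    have h3 := h1.add (h2.smul (continuousOn_const (c := Lp.const 2 P (1 : ℝ))))
    exact h3.congr fun s _ => (sub_add_cancel _ _).symm

lemma IsDGP.isMSDeriv_and_isMSContinuous [IsProbabilityMeasure P] (hI : I.OrdConnected)
    (hI' : UniqueDiffOn ℝ I) (h : HasMixedPartials I k) (hm : ContDiffOn ℝ 1 m I)
    (hD : IsDGP I m k D P) :
    IsMSDeriv I (fun t ω => (D t ω).1) (fun t ω => (D t ω).2) P ∧
      IsMSContinuous I (fun t ω => (D t ω).2) P := by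
  classical
  have hL : ∀ t, MemLp (fun ω => (D t ω).1) 2 P := fun t =>
    (hD.isGaussianProcess_fst.hasGaussianLaw_eval t).memLp_two
  have hL' : ∀ t, MemLp (fun ω => (D t ω).2) 2 P := fun t =>
    (hD.isGaussianProcess_snd.hasGaussianLaw_eval t).memLp_two
  -- The value off `I` is immaterial: all limits are taken within `I`.
  let Z : ℝ → Lp ℝ 2 P := fun t => if ht : t ∈ I then (hL ⟨t, ht⟩).toLp else 0
  let Z' : ℝ → Lp ℝ 2 P := fun t => if ht : t ∈ I then (hL' ⟨t, ht⟩).toLp else 0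
  have hZ : ∀ t : I, Z t =ᵐ[P] fun ω => (D t ω).1 := fun t => by
    simpa [Z] using (hL t).coeFn_toLp
  have hZ' : ∀ t : I, Z' t =ᵐ[P] fun ω => (D t ω).2 := fun t => by
    simpa [Z'] using (hL' t).coeFn_toLp
  obtain ⟨hder, hcont⟩ := hD.hasDerivWithinAt_toLp hI hI' h hm hZ hZ'
  refine ⟨⟨hL, hL', fun t => ?_⟩, hL', fun t => ?_⟩
  · have h1 : Tendsto (fun s : I => (s : ℝ)) (𝓝[≠] t) (𝓝[I \ {(t : ℝ)}] t) := by
      refine tendsto_nhdsWithin_iff.2 ⟨(continuous_subtype_val.tendsto t).mono_left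
        nhdsWithin_le_nhds, ?_⟩
      filter_upwards [self_mem_nhdsWithin] with s hs
      exact ⟨s.2, fun hst => hs (Subtype.ext hst)⟩
    have h2 := tendsto_iff_edist_tendsto_0.1
      ((hasDerivWithinAt_iff_tendsto_slope.1 (hder t t.2)).comp h1)
    refine h2.congr fun s => ?_
    rw [Lp.edist_def]
    refine eLpNorm_congr_ae ?_
    simp only [Function.comp_apply, slope_def_module]
    filter_upwards [hZ s, hZ t, hZ' t, Lp.coeFn_sub (Z s) (Z t),
      Lp.coeFn_smul ((s : ℝ) - t)⁻¹ (Z s - Z t)] with ω h3 h4 h5 h6 h7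
    rw [Pi.sub_apply, h7, Pi.smul_apply, h6, Pi.sub_apply, h3, h4, h5, smul_eq_mul,
      inv_mul_eq_div]
  · have h1 : Tendsto (fun s : I => (s : ℝ)) (𝓝 t) (𝓝[I] t) :=
      tendsto_nhdsWithin_iff.2 ⟨continuous_subtype_val.tendsto t,
        Eventually.of_forall fun s => s.2⟩
    have h2 := tendsto_iff_edist_tendsto_0.1 ((hcont t t.2).tendsto.comp h1)
    refine h2.congr fun s => ?_
    rw [Lp.edist_def]
    refine eLpNorm_congr_ae ?_
    filter_upwards [hZ' s, hZ' t] with ω h3 h4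
    rw [Pi.sub_apply, Function.comp_apply, h3, h4]

end Properties

end DerivativeGP

theorem proposition1 (I : Set ℝ) (hI : I.OrdConnected) (hI' : I.Nontrivial)
    (k : ℝ → ℝ → ℝ) (hk : DerivativeGP.IsKernelOn I k)
    (hk2 : ContDiffOn ℝ 2 (fun p : ℝ × ℝ => k p.1 p.2) (I ×ˢ I))
    (m : ℝ → ℝ) (hm : ContDiffOn ℝ 1 m I) :
    (∃ (Ω : Type) (_ : MeasurableSpace Ω) (P : Measure Ω) (_ : IsProbabilityMeasure P)
      (D : I → Ω → ℝ × ℝ), DerivativeGP.IsDGP I m k D P) ∧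
    (∀ (Ω : Type*) [MeasurableSpace Ω] (P : Measure Ω) [IsProbabilityMeasure P]
      (D : I → Ω → ℝ × ℝ), DerivativeGP.IsDGP I m k D P →
      DerivativeGP.IsGP I m k (fun t ω => (D t ω).1) P ∧
      DerivativeGP.IsMSC1 I (fun t ω => (D t ω).1) P ∧
      DerivativeGP.IsGP I (DerivativeGP.deriv1 I m) (DerivativeGP.partialXY I k)
        (fun t ω => (D t ω).2) P ∧
      DerivativeGP.IsMSDeriv I (fun t ω => (D t ω).1) (fun t ω => (D t ω).2) P) := by
  have hU := DerivativeGP.uniqueDiffOn_of_ordConnected hI hI'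
  have h := DerivativeGP.hasMixedPartials_of_contDiffOn hU hk2
  refine ⟨DerivativeGP.exists_isDGP hI hU hk h m, fun Ω _ P _ D hD => ?_⟩
  obtain ⟨h1, h2⟩ := hD.isMSDeriv_and_isMSContinuous hI hU h hm
  exact ⟨hD.isGP_fst, ⟨_, h1, h2⟩, hD.isGP_snd, h1⟩
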